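/- Let $\Omega$ be a non-empty set and $\mathcal A$ an algebra of subsets of $\Omega$. Let $ba(\mathcal A)$ be the space of real-valued finitely additive set functions $\mu$ on $\mathcal A$ with finite total variation norm $\|\mu\|=|\mu|(\Omega)$, where $|\mu|(B)=\sup\sum_{E\in\pi}|\mu(E)|$, the supremum running over all finite partitions $\pi$ of $B$ into elements of $\mathcal A$. For $\mu\in ba(\mathcal A)$ and $B\in\mathcal A$ let $\mu_B(A)=\mu(B\cap A)$ for $A\in\mathcal A$. Let $\mathrm{Prob}(\mathcal A)$ be the set of $\lambda\in ba(\mathcal A)$ with $\lambda\ge 0$ and $\lambda(\Omega)=1$ (finitely additive probabilities; countable additivity is not assumed). For $\lambda\in ba(\mathcal A)$ let $ba(\lambda)$ be the set of $\xi\in ba(\mathcal A)$ with $\xi\ll\lambda$, i.e. such that for every $\varepsilon>0$ there is $\delta>0$ with $|\xi(A)|<\varepsilon$ whenever $A\in\mathcal A$ and $|\lambda|(A)<\delta$. Let $(F_n)_n$ be a norm-bounded sequence in $ba(\mathcal A)$ and let $\lambda\in \mathrm{Prob}(\mathcal A)$. Then there exist $\xi\in ba(\lambda)$, a sequence $(G_n)_n$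 with $G_n$ in the convex hull $\mathrm{co}(F_n,F_{n+1},\ldots)$ for each $n$, and a sequence $(A_n)_n$ in $\mathcal A$ such that, with $\bar G_n=(G_n)_{A_n}$, $$\lim_n\|\bar G_n-\xi\|=0\qquad\text{and}\qquad\sum_n\lambda(A_n^c)<\infty .$$ -/

import Mathlib

open Filter Topology

namespace FinAdd

variable {Ω : Type*} {𝒜 : BooleanSubalgebra (Set Ω)}

/-- The sum `∑ |μ E|` over the members `E` of a finite partition of `B` into sets of `𝒜`. -/
def variationSum (μ : 𝒜 → ℝ) {B : 𝒜} (P : Finpartition B) : ℝ := ∑ E ∈ P.parts, |μ E|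

/-- The total variation `|μ|(B)`: the supremum of `∑ |μ E|` over the finite partitions
of `B` into sets of the algebra `𝒜`. -/
noncomputable def totalVariation (μ : 𝒜 → ℝ) (B : 𝒜) : ℝ :=
  ⨆ P : Finpartition B, variationSum μ P

/-- `ba 𝒜`: the space of real valued, additive set functions on the algebra `𝒜` whose total
variation is finite. -/
def ba (𝒜 : BooleanSubalgebra (Set Ω)) : Submodule ℝ (𝒜 → ℝ) where
  carrier := {μ | (∀ A B : 𝒜, Disjoint A B → μ (A ⊔ B) = μ A + μ B) ∧
    BddAbove (Set.range fun P : Finpartition (⊤ : 𝒜) => variationSum μ P)}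
  zero_mem' := by
    refine ⟨by simp, 0, ?_⟩
    rintro _ ⟨P, rfl⟩
    simp [variationSum]
  add_mem' := by
    rintro μ ν ⟨hμ, C, hC⟩ ⟨hν, D, hD⟩
    refine ⟨fun A B h => ?_, C + D, ?_⟩
    · simp only [Pi.add_apply, hμ A B h, hν A B h]; ring
    · rintro _ ⟨P, rfl⟩
      have h1 : variationSum μ P ≤ C := hC ⟨P, rfl⟩
      have h2 : variationSum ν P ≤ D := hD ⟨P, rfl⟩
      refine le_trans ?_ (add_le_add h1 h2)
      simp only [variationSum, ← Finset.sum_add_distrib]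
      exact Finset.sum_le_sum fun E _ => abs_add_le _ _
  smul_mem' := by
    rintro c μ ⟨hμ, C, hC⟩
    refine ⟨fun A B h => ?_, |c| * C, ?_⟩
    · simp only [Pi.smul_apply, hμ A B h, smul_add]
    · rintro _ ⟨P, rfl⟩
      have h1 : variationSum μ P ≤ C := hC ⟨P, rfl⟩
      have h2 : variationSum (c • μ) P = |c| * variationSum μ P := by
        simp [variationSum, Finset.mul_sum, abs_mul]
      change variationSum (c • μ) P ≤ _
      rw [h2]
      exact mul_le_mul_of_nonneg_left h1 (abs_nonneg c)

/-- The total variation norm `‖μ‖ = |μ|(Ω)` on `ba 𝒜`. -/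
noncomputable def tvNorm (μ : ba 𝒜) : ℝ := totalVariation (μ : 𝒜 → ℝ) ⊤

/-- The restriction `μ_B` of `μ` to a set `B` of the algebra: `μ_B(A) = μ(B ∩ A)`. -/
def restrict (μ : ba 𝒜) (B : 𝒜) : ba 𝒜 where
  val := fun A => (μ : 𝒜 → ℝ) (B ⊓ A)
  property := by
    classical
    obtain ⟨μ, hμ, C, hC⟩ := μ
    have h0 : μ ⊥ = 0 := by
      have := hμ ⊥ ⊥ disjoint_bot_left
      rw [sup_idem] at this
      linarith
    refine ⟨fun A A' h => ?_, C, ?_⟩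
    · have := hμ (B ⊓ A) (B ⊓ A') (h.mono inf_le_right inf_le_right)
      rw [← inf_sup_left] at this
      exact this
    · rintro _ ⟨P, rfl⟩
      have h1 : variationSum (fun A => μ (B ⊓ A)) P
          = variationSum μ (P.restrict (le_top : B ≤ ⊤)) := by
        unfold variationSum
        rw [Finpartition.sum_restrict P le_top (fun A => |μ A|) (by simp [h0])]
        refine Finset.sum_congr rfl fun E _ => ?_
        rw [inf_comm]
      have h2 : variationSum μ ((P.restrict (le_top : B ≤ ⊤)).extendOfLE le_top) ≤ C :=
        hC ⟨_, rfl⟩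
      change variationSum (fun A => μ (B ⊓ A)) P ≤ C
      rw [h1]
      refine le_trans ?_ h2
      exact Finset.sum_le_sum_of_subset_of_nonneg (Finpartition.parts_subset_extendOfLE _ _)
        fun _ _ _ => abs_nonneg _

/-- `Prob 𝒜`: the finitely additive probabilities on `𝒜`. -/
def Prob (𝒜 : BooleanSubalgebra (Set Ω)) : Set (ba 𝒜) :=
  {μ | (∀ A : 𝒜, 0 ≤ (μ : 𝒜 → ℝ) A) ∧ (μ : 𝒜 → ℝ) ⊤ = 1}

/-- Absolute continuity `ξ ≪ ν` of (finitely) additive set functions: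
`ξ(A) → 0` as `|ν|(A) → 0`. -/
def AbsCont (ξ ν : ba 𝒜) : Prop :=
  ∀ ε > 0, ∃ δ > 0, ∀ A : 𝒜, totalVariation (ν : 𝒜 → ℝ) A < δ → |(ξ : 𝒜 → ℝ) A| < ε

/-- `ba(ν)`: the members of `ba 𝒜` that are absolutely continuous with respect to `ν`. -/
def baAbs (ν : ba 𝒜) : Set (ba 𝒜) := {ξ | AbsCont ξ ν}

/-- The sequences `G` with `Gₙ` in the convex hull of `{Fₙ, Fₙ₊₁, …}` for each `n`. -/
def Gam (F : ℕ → ba 𝒜) : Set (ℕ → ba 𝒜) :=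
  {G | ∀ n, G n ∈ convexHull ℝ (F '' Set.Ici n)}

end FinAdd

namespace FinAdd

variable {Ω : Type*} {𝒜 : BooleanSubalgebra (Set Ω)}

/-! A subsequence splitting of Kadec–Pełczyński type is followed by a Hilbert space argument;
neither uses countable additivity. Splitting (`exists_splitting`): along a subsequence, `F (φ j)`
agrees with `H j` off a set `D j`, up to errors of order `2⁻ʲ`, where `ν (D j)` is also of order
`2⁻ʲ`. For positive `F` one takes `H j = F (φ j) ∧ t ν` with `t` growing like `2ʲ`; the subsequence
is chosen so that, up to `ε`, `H` is eventually dominated by a fixed multiple of `ν`. Convergence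
(`AsympDominated.exists_comb_tendsto`): a set function dominated by `k ν` behaves like an element of
L²(ν), with squared norm the supremum of `∑ μ(E)²/ν(E)` over partitions. Almost minimal forward
convex combinations are Cauchy by the parallelogram identity. Minimising over weights rather than
measures makes one sequence of weights serve all domination levels, hence `H` itself. Conclusion:
the same weights are applied to `F ∘ φ`, and the union of the sets `D j` in use is removed. Weights
supported in `[n, ∞)` make its `ν`-mass at most a geometric tail. The limit is approximable by set
functions dominated by multiples of `ν`, so it is absolutely continuous and negligible on the
removed sets. -/

/-! ### Additivity and the total variation norm. -/

lemma ba_sup (μ : ba 𝒜) {A B : 𝒜} (h : Disjoint A B) : μ.1 (A ⊔ B) = μ.1 A + μ.1 B :=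
  μ.2.1 A B h

@[simp] lemma ba_bot (μ : ba 𝒜) : μ.1 ⊥ = 0 := by
  have := ba_sup μ (disjoint_bot_left : Disjoint (⊥ : 𝒜) ⊥)
  rw [sup_idem] at this
  linarith

lemma ba_inf_compl (μ : ba 𝒜) (A B : 𝒜) : μ.1 A = μ.1 (A ⊓ B) + μ.1 (A ⊓ Bᶜ) := by
  rw [← ba_sup μ (disjoint_compl_right.mono inf_le_right inf_le_right), ← inf_sup_left,
    sup_compl_eq_top, inf_top_eq]

lemma ba_compl (μ : ba 𝒜) (A : 𝒜) : μ.1 Aᶜ = μ.1 ⊤ - μ.1 A := by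
  have := ba_inf_compl μ ⊤ A
  simp only [top_inf_eq] at this
  linarith

lemma ba_finset_sup {ι : Type*} (μ : ba 𝒜) (s : Finset ι) (f : ι → 𝒜) (hs : s.SupIndep f) :
    μ.1 (s.sup f) = ∑ i ∈ s, μ.1 (f i) := by
  classical
  induction s using Finset.induction_on with
  | empty => simp
  | insert a s ha ih =>
    rw [Finset.sup_insert, Finset.sum_insert ha, ba_sup, ih (hs.subset (Finset.subset_insert _ _))]
    exact hs (Finset.subset_insert _ _) (Finset.mem_insert_self _ _) ha

lemma ba_finpartition (μ : ba 𝒜) {B : 𝒜} (P : Finpartition B) :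
    μ.1 B = ∑ E ∈ P.parts, μ.1 E := by
  have := ba_finset_sup μ P.parts id P.supIndep
  rwa [P.sup_parts] at this

lemma ba_inf_finpartition (μ : ba 𝒜) (P : Finpartition (⊤ : 𝒜)) (B : 𝒜) :
    μ.1 B = ∑ E ∈ P.parts, μ.1 (B ⊓ E) := by
  have := ba_finpartition (restrict μ B) P
  simpa [restrict] using this

lemma variationSum_nonneg (μ : 𝒜 → ℝ) {B : 𝒜} (P : Finpartition B) : 0 ≤ variationSum μ P :=
  Finset.sum_nonneg fun _ _ => abs_nonneg _

lemma variationSum_le_tvNorm (μ : ba 𝒜) (P : Finpartition (⊤ : 𝒜)) :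
    variationSum μ.1 P ≤ tvNorm μ :=
  le_ciSup μ.2.2 P

lemma tvNorm_le {μ : ba 𝒜} {c : ℝ} (h : ∀ P : Finpartition (⊤ : 𝒜), variationSum μ.1 P ≤ c) :
    tvNorm μ ≤ c :=
  ciSup_le h

lemma tvNorm_nonneg (μ : ba 𝒜) : 0 ≤ tvNorm μ :=
  Real.iSup_nonneg fun P => variationSum_nonneg _ P

lemma tvNorm_add_le (μ κ : ba 𝒜) : tvNorm (μ + κ) ≤ tvNorm μ + tvNorm κ :=
  tvNorm_le fun P => by
    refine le_trans ?_ (add_le_add (variationSum_le_tvNorm μ P) (variationSum_le_tvNorm κ P))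
    simp only [variationSum, ← Finset.sum_add_distrib]
    exact Finset.sum_le_sum fun E _ => abs_add_le _ _

lemma tvNorm_smul_le (c : ℝ) (μ : ba 𝒜) : tvNorm (c • μ) ≤ |c| * tvNorm μ :=
  tvNorm_le fun P => by
    refine le_trans (le_of_eq ?_)
      (mul_le_mul_of_nonneg_left (variationSum_le_tvNorm μ P) (abs_nonneg c))
    simp [variationSum, Finset.mul_sum, abs_mul]

lemma tvNorm_neg (μ : ba 𝒜) : tvNorm (-μ) = tvNorm μ := by
  simp [tvNorm, totalVariation, variationSum]

lemma tvNorm_sub_le (μ κ : ba 𝒜) : tvNorm (μ - κ) ≤ tvNorm μ + tvNorm κ := by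
  rw [sub_eq_add_neg, ← tvNorm_neg κ]
  exact tvNorm_add_le _ _

lemma tvNorm_sub_comm (μ κ : ba 𝒜) : tvNorm (μ - κ) = tvNorm (κ - μ) := by
  rw [← tvNorm_neg, neg_sub]

lemma tvNorm_sub_le_sub_add_sub (μ κ ρ : ba 𝒜) :
    tvNorm (μ - ρ) ≤ tvNorm (μ - κ) + tvNorm (κ - ρ) := by
  have := tvNorm_add_le (μ - κ) (κ - ρ)
  rwa [sub_add_sub_cancel] at this

lemma abs_apply_le_tvNorm (μ : ba 𝒜) (A : 𝒜) : |μ.1 A| ≤ tvNorm μ := by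
  classical
  by_cases hA : A = ⊥
  · simpa [hA] using tvNorm_nonneg μ
  refine le_trans ?_ (variationSum_le_tvNorm μ ((Finpartition.indiscrete hA).extendOfLE le_top))
  refine Finset.single_le_sum (f := fun E => |μ.1 E|) (fun _ _ => abs_nonneg _) ?_
  exact Finpartition.parts_subset_extendOfLE _ _ (by simp [Finpartition.indiscrete])

lemma restrict_apply (μ : ba 𝒜) (A B : 𝒜) : (restrict μ B).1 A = μ.1 (B ⊓ A) := rfl

/-- Cutting a partition of `Ω` by `B` and completing it outside `B` can only add nonnegative terms.
-/
lemma tvNorm_restrict_le (μ : ba 𝒜) (B : 𝒜) : tvNorm (restrict μ B) ≤ tvNorm μ := by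
  classical
  refine tvNorm_le fun P => le_trans ?_
    (variationSum_le_tvNorm μ ((P.restrict (le_top : B ≤ ⊤)).extendOfLE le_top))
  have h1 : variationSum (restrict μ B).1 P
      = variationSum μ.1 (P.restrict (le_top : B ≤ ⊤)) := by
    unfold variationSum
    rw [Finpartition.sum_restrict P le_top (fun A => |μ.1 A|) (by simp)]
    refine Finset.sum_congr rfl fun E _ => ?_
    rw [inf_comm]
    rfl
  rw [h1]
  exact Finset.sum_le_sum_of_subset_of_nonneg (Finpartition.parts_subset_extendOfLE _ _)
    fun _ _ _ => abs_nonneg _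

lemma tvNorm_restrict_mono (μ : ba 𝒜) {B B' : 𝒜} (h : B ≤ B') :
    tvNorm (restrict μ B) ≤ tvNorm (restrict μ B') := by
  have : restrict μ B = restrict (restrict μ B') B := by
    ext A
    simp [restrict, ← inf_assoc, inf_eq_right.2 h]
  rw [this]
  exact tvNorm_restrict_le _ _

/-- Restriction to `B` as a linear map. -/
def restrictₗ (B : 𝒜) : ba 𝒜 →ₗ[ℝ] ba 𝒜 where
  toFun μ := restrict μ B
  map_add' _ _ := rfl
  map_smul' _ _ := rfl

lemma restrict_add (μ κ : ba 𝒜) (B : 𝒜) : restrict (μ + κ) B = restrict μ B + restrict κ B := rfl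

lemma restrict_sub (μ κ : ba 𝒜) (B : 𝒜) : restrict (μ - κ) B = restrict μ B - restrict κ B := rfl

lemma sub_restrict (μ : ba 𝒜) (B : 𝒜) : μ - restrict μ B = restrict μ Bᶜ := by
  ext A
  have := ba_inf_compl μ A B
  simp only [restrict, AddSubgroupClass.coe_sub, Pi.sub_apply, inf_comm _ A]
  linarith

lemma tvNorm_le_of_dominated {μ κ : ba 𝒜} (h : ∀ A, |μ.1 A| ≤ κ.1 A) : tvNorm μ ≤ κ.1 ⊤ :=
  tvNorm_le fun P => by
    rw [ba_finpartition κ P]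
    exact Finset.sum_le_sum fun E _ => h E

lemma tvNorm_le_of_nonneg {μ : ba 𝒜} (h : ∀ A, 0 ≤ μ.1 A) : tvNorm μ ≤ μ.1 ⊤ :=
  tvNorm_le_of_dominated fun A => (abs_of_nonneg (h A)).le

lemma ba_mono {μ : ba 𝒜} (h : ∀ A, 0 ≤ μ.1 A) {A B : 𝒜} (hAB : A ≤ B) : μ.1 A ≤ μ.1 B := by
  have := ba_inf_compl μ B A
  rw [inf_eq_right.2 hAB] at this
  linarith [h (B ⊓ Aᶜ)]

lemma ba_finset_sup_le {ι : Type*} {μ : ba 𝒜} (h : ∀ A, 0 ≤ μ.1 A) (s : Finset ι) (f : ι → 𝒜) :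
    μ.1 (s.sup f) ≤ ∑ i ∈ s, μ.1 (f i) := by
  classical
  induction s using Finset.induction_on with
  | empty => simp
  | insert a s ha ih =>
    rw [Finset.sup_insert, Finset.sum_insert ha]
    have h1 : f a ⊔ s.sup f = f a ⊔ (s.sup f ⊓ (f a)ᶜ) := by
      rw [sup_inf_left, sup_compl_eq_top, inf_top_eq]
    rw [h1, ba_sup μ (disjoint_compl_right.mono_right inf_le_right)]
    linarith [ba_mono h (inf_le_left : s.sup f ⊓ (f a)ᶜ ≤ s.sup f)]

/-- Converts the smallness of `|ν|(A)` in `AbsCont` into smallness of `ν(A)`. The one-block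
partition gives the bound; it exists only for `A ≠ ⊥`. -/
lemma apply_le_totalVariation {μ : ba 𝒜} (h : ∀ A, 0 ≤ μ.1 A) (A : 𝒜) :
    μ.1 A ≤ totalVariation μ.1 A := by
  have hb : BddAbove (Set.range fun P : Finpartition A => variationSum μ.1 P) := by
    refine ⟨μ.1 A, ?_⟩
    rintro _ ⟨P, rfl⟩
    rw [ba_finpartition μ P]
    exact Finset.sum_le_sum fun E _ => (abs_of_nonneg (h E)).le
  by_cases hA : A = ⊥
  · subst hA
    rw [ba_bot]
    exact Real.iSup_nonneg fun P => variationSum_nonneg _ P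
  refine le_trans ?_ (le_ciSup hb (Finpartition.indiscrete hA))
  simp [variationSum, le_abs_self]

/-! ### Completeness of `ba 𝒜`. -/

lemma exists_tendsto_of_cauchy (H : ℕ → ba 𝒜)
    (hH : ∀ ε > 0, ∃ N, ∀ n ≥ N, ∀ m ≥ N, tvNorm (H n - H m) ≤ ε) :
    ∃ ξ : ba 𝒜, ∀ ε > 0, ∃ N, ∀ n ≥ N, tvNorm (H n - ξ) ≤ ε := by
  have hc : ∀ A : 𝒜, ∃ x, Tendsto (fun n => (H n).1 A) atTop (𝓝 x) := fun A => by
    refine cauchySeq_tendsto_of_complete (Metric.cauchySeq_iff.2 fun ε hε => ?_)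
    obtain ⟨N, hN⟩ := hH (ε / 2) (half_pos hε)
    refine ⟨N, fun n hn m hm => ?_⟩
    rw [Real.dist_eq]
    have := (abs_apply_le_tvNorm (H n - H m) A).trans (hN n hn m hm)
    change |(H n).1 A - (H m).1 A| ≤ _ at this
    linarith
  choose x hx using hc
  -- Each variation sum is finite, so the Cauchy bound survives the setwise limit, with `N`
  -- independent of the partition.
  have hlim : ∀ ε > 0, ∃ N, ∀ n ≥ N, ∀ P : Finpartition (⊤ : 𝒜),
      variationSum ((H n).1 - x) P ≤ ε := fun ε hε => by
    obtain ⟨N, hN⟩ := hH ε hε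
    refine ⟨N, fun n hn P => ?_⟩
    refine le_of_tendsto (f := fun m => variationSum ((H n).1 - (H m).1) P) (x := atTop) ?_
      (eventually_atTop.2 ⟨N, fun m hm =>
        (variationSum_le_tvNorm (H n - H m) P).trans (hN n hn m hm)⟩)
    exact tendsto_finsetSum _ fun E _ => (tendsto_const_nhds.sub (hx E)).abs
  have hmem : x ∈ ba 𝒜 := by
    refine ⟨fun A B h => ?_, ?_⟩
    · refine tendsto_nhds_unique (hx (A ⊔ B)) ?_
      simp only [ba_sup _ h]
      exact (hx A).add (hx B)
    · obtain ⟨N, hN⟩ := hlim 1 one_pos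
      refine ⟨tvNorm (H N) + 1, ?_⟩
      rintro _ ⟨P, rfl⟩
      refine le_trans ?_ (add_le_add (variationSum_le_tvNorm (H N) P) (hN N le_rfl P))
      simp only [variationSum, ← Finset.sum_add_distrib]
      refine Finset.sum_le_sum fun E _ => ?_
      have := abs_sub (( H N).1 E) (((H N).1 - x) E)
      simpa using this
  refine ⟨⟨x, hmem⟩, fun ε hε => ?_⟩
  obtain ⟨N, hN⟩ := hlim ε hε
  exact ⟨N, fun n hn => tvNorm_le fun P => hN n hn P⟩

/-! ### Positive parts and truncation at a multiple of `ν`. -/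

/-- A nonnegative additive set function belongs to `ba`. -/
def ofNonneg (f : 𝒜 → ℝ) (hadd : ∀ A B, Disjoint A B → f (A ⊔ B) = f A + f B)
    (h0 : ∀ A, 0 ≤ f A) : ba 𝒜 where
  val := f
  property := by
    refine ⟨hadd, f ⊤, ?_⟩
    rintro _ ⟨P, rfl⟩
    have hb : f ⊥ = 0 := by
      have := hadd ⊥ ⊥ disjoint_bot_left
      rw [sup_idem] at this
      linarith
    have hsup : ∀ s : Finset 𝒜, s.SupIndep id → ∑ E ∈ s, f E = f (s.sup id) := by
      classical
      intro s
      induction s using Finset.induction_on with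
      | empty => simp [hb]
      | insert a s ha ih =>
        intro hs
        rw [Finset.sup_insert, Finset.sum_insert ha, hadd,
          ih (hs.subset (Finset.subset_insert _ _))]
        · rfl
        · exact hs (Finset.subset_insert _ _) (Finset.mem_insert_self _ _) ha
    have := hsup P.parts P.supIndep
    rw [P.sup_parts] at this
    rw [← this]
    exact Finset.sum_le_sum fun E _ => (abs_of_nonneg (h0 E)).le

lemma bddAbove_apply_inf (μ : ba 𝒜) (A : 𝒜) : BddAbove (Set.range fun B => μ.1 (B ⊓ A)) := by
  refine ⟨tvNorm μ, ?_⟩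
  rintro _ ⟨B, rfl⟩
  exact (le_abs_self _).trans (abs_apply_le_tvNorm μ _)

/-- The positive part `μ⁺(A) = sup {μ(B) : B ⊆ A}`. -/
noncomputable def posPart (μ : ba 𝒜) : ba 𝒜 :=
  ofNonneg (fun A => ⨆ B : 𝒜, μ.1 (B ⊓ A))
    (fun A A' h => by
      apply le_antisymm
      · refine ciSup_le fun B => ?_
        rw [inf_sup_left, ba_sup μ (h.mono inf_le_right inf_le_right)]
        exact add_le_add (le_ciSup (bddAbove_apply_inf μ A) B) (le_ciSup (bddAbove_apply_inf μ A') B)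
      -- Competitors inside the disjoint sets `A` and `A'` glue to one inside the union.
      · refine ciSup_add_ciSup_le fun B B' => ?_
        refine le_trans (le_of_eq ?_)
          (le_ciSup (bddAbove_apply_inf μ (A ⊔ A')) (B ⊓ A ⊔ B' ⊓ A'))
        have hle : B ⊓ A ⊔ B' ⊓ A' ≤ A ⊔ A' := sup_le_sup inf_le_right inf_le_right
        rw [← ba_sup μ (h.mono inf_le_right inf_le_right), inf_eq_left.2 hle])
    (fun A => by
      have := le_ciSup (bddAbove_apply_inf μ A) ⊥
      simpa using this)

lemma posPart_nonneg (μ : ba 𝒜) (A : 𝒜) : 0 ≤ (posPart μ).1 A := by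
  have := le_ciSup (bddAbove_apply_inf μ A) ⊥
  simpa [posPart, ofNonneg] using this

lemma le_posPart (μ : ba 𝒜) (A : 𝒜) : μ.1 A ≤ (posPart μ).1 A := by
  have := le_ciSup (bddAbove_apply_inf μ A) ⊤
  simpa [posPart, ofNonneg] using this

lemma posPart_le {μ : ba 𝒜} {A : 𝒜} {c : ℝ} (h : ∀ B ≤ A, μ.1 B ≤ c) : (posPart μ).1 A ≤ c :=
  ciSup_le fun _ => h _ inf_le_right

lemma posPart_mono {μ κ : ba 𝒜} (h : ∀ A, μ.1 A ≤ κ.1 A) (A : 𝒜) :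
    (posPart μ).1 A ≤ (posPart κ).1 A :=
  ciSup_mono (bddAbove_apply_inf κ A) fun _ => h _

lemma exists_lt_apply_of_posPart (μ : ba 𝒜) {ε : ℝ} (hε : 0 < ε) :
    ∃ D : 𝒜, (posPart μ).1 ⊤ - ε < μ.1 D := by
  obtain ⟨D, hD⟩ := exists_lt_of_lt_ciSup
    (show (posPart μ).1 ⊤ - ε < ⨆ B : 𝒜, μ.1 (B ⊓ ⊤) from sub_lt_self _ hε)
  exact ⟨D, by simpa using hD⟩

/-- The infimum `μ ∧ tν` in `ba 𝒜`. -/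
noncomputable def trunc (μ ν : ba 𝒜) (t : ℝ) : ba 𝒜 := μ - posPart (μ - t • ν)

lemma trunc_apply (μ ν : ba 𝒜) (t : ℝ) (A : 𝒜) :
    (trunc μ ν t).1 A = μ.1 A - (posPart (μ - t • ν)).1 A := rfl

lemma sub_smul_apply (μ ν : ba 𝒜) (t : ℝ) (A : 𝒜) :
    (μ - t • ν).1 A = μ.1 A - t * ν.1 A := rfl

lemma trunc_le (μ ν : ba 𝒜) (t : ℝ) (A : 𝒜) : (trunc μ ν t).1 A ≤ t * ν.1 A := by
  have := le_posPart (μ - t • ν) A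
  rw [sub_smul_apply] at this
  rw [trunc_apply]
  linarith

lemma trunc_le_self (μ ν : ba 𝒜) (t : ℝ) (A : 𝒜) : (trunc μ ν t).1 A ≤ μ.1 A := by
  rw [trunc_apply]
  linarith [posPart_nonneg (μ - t • ν) A]

lemma trunc_nonneg {μ ν : ba 𝒜} (hμ : ∀ A, 0 ≤ μ.1 A) (hν : ∀ A, 0 ≤ ν.1 A) {t : ℝ} (ht : 0 ≤ t)
    (A : 𝒜) : 0 ≤ (trunc μ ν t).1 A := by
  rw [trunc_apply, sub_nonneg]
  refine posPart_le fun B hB => ?_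
  rw [sub_smul_apply]
  linarith [ba_mono hμ hB, mul_nonneg ht (hν B)]

lemma trunc_mono {μ ν : ba 𝒜} (hν : ∀ A, 0 ≤ ν.1 A) {s t : ℝ} (hst : s ≤ t) (A : 𝒜) :
    (trunc μ ν s).1 A ≤ (trunc μ ν t).1 A := by
  rw [trunc_apply, trunc_apply]
  refine sub_le_sub_left (posPart_mono (fun B => ?_) A) _
  rw [sub_smul_apply, sub_smul_apply]
  linarith [mul_le_mul_of_nonneg_right hst (hν B)]

/-- The part of `μ` above `tν` is concentrated, up to `ε`, on a set of small `ν`-mass. -/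
lemma exists_restrict_sub_trunc_le {μ ν : ba 𝒜} (t : ℝ) {ε : ℝ} (hε : 0 < ε) :
    ∃ D : 𝒜, t * ν.1 D ≤ μ.1 D + ε ∧ tvNorm (restrict (μ - trunc μ ν t) Dᶜ) ≤ ε := by
  -- `D` is a Hahn set of `μ - tν` up to `ε`: the positive part has almost all its mass on `D`,
  -- hence at most `ε` on the complement.
  obtain ⟨D, hD⟩ := exists_lt_apply_of_posPart (μ - t • ν) hε
  have h0 := posPart_nonneg (μ - t • ν) ⊤
  have h1 := le_posPart (μ - t • ν) D
  refine ⟨D, ?_, ?_⟩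
  · rw [sub_smul_apply] at hD
    linarith
  · have h2 : μ - trunc μ ν t = posPart (μ - t • ν) := by rw [trunc, sub_sub_cancel]
    rw [h2]
    refine (tvNorm_le_of_nonneg fun A => posPart_nonneg (μ - t • ν) (Dᶜ ⊓ A)).trans ?_
    rw [restrict_apply, inf_top_eq, ba_compl]
    linarith

/-! ### Asymptotic domination and subsequence splitting. -/

/-- A sequence in `ba 𝒜` that is, up to `ε` and eventually, dominated by a multiple of `ν`. -/
def AsympDominated (ν : ba 𝒜) (H : ℕ → ba 𝒜) : Prop :=
  ∀ ε > 0, ∃ k : ℝ, ∃ N, ∀ j ≥ N, ∃ T : ba 𝒜, (∀ A, |T.1 A| ≤ k * ν.1 A) ∧ tvNorm (H j - T) ≤ ε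

lemma AsympDominated.comp {ν : ba 𝒜} {H : ℕ → ba 𝒜} (h : AsympDominated ν H) {φ : ℕ → ℕ}
    (hφ : StrictMono φ) : AsympDominated ν (H ∘ φ) := fun ε hε => by
  obtain ⟨k, N, hN⟩ := h ε hε
  exact ⟨k, N, fun j hj => hN _ (hj.trans (hφ.id_le j))⟩

lemma AsympDominated.sub {ν : ba 𝒜} {H H' : ℕ → ba 𝒜} (h : AsympDominated ν H)
    (h' : AsympDominated ν H') : AsympDominated ν (fun j => H j - H' j) := fun ε hε => by
  obtain ⟨k, N, hN⟩ := h (ε / 2) (half_pos hε)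
  obtain ⟨k', N', hN'⟩ := h' (ε / 2) (half_pos hε)
  refine ⟨k + k', max N N', fun j hj => ?_⟩
  obtain ⟨T, hT, hHT⟩ := hN j (le_of_max_le_left hj)
  obtain ⟨T', hT', hHT'⟩ := hN' j (le_of_max_le_right hj)
  refine ⟨T - T', fun A => ?_, ?_⟩
  · have := abs_sub (T.1 A) (T'.1 A)
    change |T.1 A - T'.1 A| ≤ _
    linarith [hT A, hT' A]
  · rw [sub_sub_sub_comm]
    linarith [tvNorm_sub_le (H j - T) (H' j - T')]

/-- Subsequence splitting for bounded sequences of positive set functions. -/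
lemma exists_splitting_of_nonneg {ν : ba 𝒜} (hν : ν ∈ Prob 𝒜) {F : ℕ → ba 𝒜}
    (hF : ∀ n A, 0 ≤ (F n).1 A) {C : ℝ} (hC : ∀ n, (F n).1 ⊤ ≤ C) :
    ∃ φ : ℕ → ℕ, StrictMono φ ∧ ∃ (H : ℕ → ba 𝒜) (D : ℕ → 𝒜), AsympDominated ν H ∧
      ∀ j, ν.1 (D j) ≤ (1 / 2) ^ j ∧ tvNorm (restrict (F (φ j) - H j) (D j)ᶜ) ≤ (1 / 2) ^ j := by
  have hν0 : ∀ A, 0 ≤ ν.1 A := hν.1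
  have hC0 : 0 ≤ C := (hF 0 ⊤).trans (hC 0)
  -- With this level, `t j * ν(D) ≤ F(D) + 2⁻ʲ ≤ C + 1` yields `ν(D) ≤ 2⁻ʲ`.
  let t : ℕ → ℝ := fun k => (C + 1) * 2 ^ k
  have ht0 : ∀ k, 0 ≤ t k := fun k => by positivity
  have htm : Monotone t := fun k l h =>
    mul_le_mul_of_nonneg_left (pow_le_pow_right₀ one_le_two h) (by positivity)
  let p : ℕ → ℕ → ℝ := fun i k => (trunc (F i) ν (t k)).1 ⊤
  have hp : ∀ i, p i ∈ Set.pi Set.univ fun _ => Set.Icc 0 C := fun i k _ =>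
    ⟨trunc_nonneg (hF i) hν0 (ht0 k) _, (trunc_le_self _ _ _ _).trans (hC i)⟩
  -- Compactness of the product makes the truncated masses converge at every level along one
  -- subsequence.
  obtain ⟨L, hL, φ₀, hφ₀, hlim⟩ :=
    (isCompact_univ_pi fun _ : ℕ => isCompact_Icc).tendsto_subseq hp
  rw [tendsto_pi_nhds] at hlim
  have hLm : Monotone L := fun k l h =>
    le_of_tendsto_of_tendsto' (hlim k) (hlim l) fun i => trunc_mono hν0 (htm h) _
  have hLb : BddAbove (Set.range L) := ⟨C, by rintro _ ⟨k, rfl⟩; exact (hL k trivial).2⟩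
  have hpow : ∀ j : ℕ, (0 : ℝ) < (1 / 2) ^ j := fun j => by positivity
  -- The truncation level grows so slowly along the new subsequence that the mass at level `j` stays
  -- near `L j`.
  obtain ⟨φ₁, hφ₁, hsub⟩ := extraction_forall_of_eventually
    (P := fun j i => p (φ₀ i) j < L j + (1 / 2) ^ j)
    fun j => (hlim j).eventually_lt_const (lt_add_of_pos_right _ (hpow j))
  have hD : ∀ j, ∃ D : 𝒜, ν.1 D ≤ (1 / 2) ^ j ∧ tvNorm (restrict
      (F (φ₀ (φ₁ j)) - trunc (F (φ₀ (φ₁ j))) ν (t j)) Dᶜ) ≤ (1 / 2) ^ j := fun j => by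
    obtain ⟨D, h1, h2⟩ := exists_restrict_sub_trunc_le (μ := F (φ₀ (φ₁ j))) (ν := ν) (t j) (hpow j)
    refine ⟨D, ?_, h2⟩
    have h3 : (C + 1) * (2 ^ j * ν.1 D) ≤ (C + 1) * 1 := by
      have h4 : (1 / 2 : ℝ) ^ j ≤ 1 := pow_le_one₀ (by norm_num) (by norm_num)
      have h5 := (ba_mono (hF (φ₀ (φ₁ j))) (le_top : D ≤ ⊤)).trans (hC _)
      rw [← mul_assoc]
      change t j * _ ≤ _
      linarith
    have h6 := le_of_mul_le_mul_left h3 (by positivity)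
    rw [one_div, inv_pow, ← one_div, le_div_iff₀' (by positivity)]
    exact h6
  choose D hD using hD
  refine ⟨φ₀ ∘ φ₁, hφ₀.comp hφ₁, fun j => trunc (F (φ₀ (φ₁ j))) ν (t j), D, fun ε hε => ?_, hD⟩
  have hε3 : 0 < ε / 3 := by positivity
  -- The mass between levels `k` and `j` is at most `(L j + 2⁻ʲ) - (L k - ε/3)`, and `L k` is within
  -- `ε/3` of the supremum.
  obtain ⟨k, hk⟩ := exists_lt_of_lt_ciSup (sub_lt_self (⨆ k, L k) hε3)
  have e1 : ∀ᶠ j in atTop, L k - ε / 3 < p (φ₀ (φ₁ j)) k :=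
    ((hlim k).comp hφ₁.tendsto_atTop).eventually_const_lt (sub_lt_self _ hε3)
  have e2 : ∀ᶠ j : ℕ in atTop, (1 / 2 : ℝ) ^ j < ε / 3 :=
    (tendsto_pow_atTop_nhds_zero_of_lt_one (by norm_num) (by norm_num)).eventually_lt_const hε3
  obtain ⟨N, hN⟩ := eventually_atTop.1 (e1.and (e2.and (eventually_ge_atTop k)))
  refine ⟨t k, N, fun j hj => ⟨trunc (F (φ₀ (φ₁ j))) ν (t k), fun A => ?_, ?_⟩⟩
  · rw [abs_of_nonneg (trunc_nonneg (hF _) hν0 (ht0 k) _)]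
    exact trunc_le _ _ _ _
  · obtain ⟨h1, h2, h3⟩ := hN j hj
    refine (tvNorm_le_of_nonneg fun A => sub_nonneg.2 (trunc_mono hν0 (htm h3) A)).trans ?_
    change p (φ₀ (φ₁ j)) j - p (φ₀ (φ₁ j)) k ≤ ε
    linarith [hsub j, le_ciSup hLb j]

/-- Subsequence splitting for bounded sequences in `ba 𝒜`. -/
lemma exists_splitting {ν : ba 𝒜} (hν : ν ∈ Prob 𝒜) {F : ℕ → ba 𝒜}
    {C : ℝ} (hC : ∀ n, tvNorm (F n) ≤ C) :
    ∃ φ : ℕ → ℕ, StrictMono φ ∧ ∃ (H : ℕ → ba 𝒜) (D : ℕ → 𝒜), AsympDominated ν H ∧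
      ∀ j, ν.1 (D j) ≤ 2 * (1 / 2) ^ j ∧
        tvNorm (restrict (F (φ j) - H j) (D j)ᶜ) ≤ 2 * (1 / 2) ^ j := by
  have hb : ∀ n, (posPart (F n)).1 ⊤ ≤ C := fun n => posPart_le fun B _ =>
    (le_abs_self _).trans ((abs_apply_le_tvNorm _ _).trans (hC n))
  obtain ⟨φ, hφ, H, D, hH, hD⟩ := exists_splitting_of_nonneg hν (fun n => posPart_nonneg (F n)) hb
  -- The negative part `F⁺ - F` is split along a further subsequence.
  obtain ⟨ψ, hψ, H', D', hH', hD'⟩ := exists_splitting_of_nonneg hν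
    (F := fun n => posPart (F (φ n)) - F (φ n)) (C := C + C)
    (fun n A => sub_nonneg.2 (le_posPart _ _)) fun n => by
      change (posPart (F (φ n))).1 ⊤ - (F (φ n)).1 ⊤ ≤ C + C
      linarith [hb (φ n), hC (φ n), neg_abs_le ((F (φ n)).1 ⊤), abs_apply_le_tvNorm (F (φ n)) ⊤]
  refine ⟨φ ∘ ψ, hφ.comp hψ, fun j => H (ψ j) - H' j, fun j => D (ψ j) ⊔ D' j,
    (hH.comp hψ).sub hH', fun j => ?_⟩
  have hpow : (1 / 2 : ℝ) ^ (ψ j) ≤ (1 / 2) ^ j :=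
    pow_le_pow_of_le_one (by norm_num) (by norm_num) (hψ.id_le j)
  constructor
  · have h1 := ba_finset_sup_le hν.1 {true, false} fun b => if b then D (ψ j) else D' j
    simp only [Finset.sup_insert, Finset.sup_singleton, Finset.mem_singleton, reduceCtorEq,
      not_false_eq_true, Finset.sum_insert, Finset.sum_singleton, if_true] at h1
    have h2 := (hD (ψ j)).1
    have h3 := (hD' j).1
    refine h1.trans ?_
    simp only [if_false]
    linarith
  · have h1 : F (φ (ψ j)) - (H (ψ j) - H' j) = (posPart (F (φ (ψ j))) - H (ψ j)) -
      (posPart (F (φ (ψ j))) - F (φ (ψ j)) - H' j) := by abel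
    simp only [Function.comp_apply]
    rw [h1, restrict_sub]
    refine (tvNorm_sub_le _ _).trans ?_
    have h2 := (tvNorm_restrict_mono (posPart (F (φ (ψ j))) - H (ψ j))
      (compl_le_compl (le_sup_left : D (ψ j) ≤ D (ψ j) ⊔ D' j))).trans (hD (ψ j)).2
    have h3 := (tvNorm_restrict_mono (posPart (F (φ (ψ j))) - F (φ (ψ j)) - H' j)
      (compl_le_compl (le_sup_right : D' j ≤ D (ψ j) ⊔ D' j))).trans (hD' j).2
    linarith

/-! ### Almost minimisers and the parallelogram identity. -/

/-- Minimal elements of a decreasing sequence of convex sets are Cauchy for a directed family of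
quadratic functionals. -/
lemma exists_cauchy_of_parallelogram {E ι : Type*} [AddCommGroup E] [Module ℝ E] [Nonempty ι]
    (q : ι → E → ℝ) (Δ : ℕ → Set E) (hanti : Antitone Δ) (hconv : ∀ n, Convex ℝ (Δ n))
    (hne : ∀ n, (Δ n).Nonempty) {C : ℝ} (hC : ∀ a, ∀ x ∈ Δ 0, q a x ≤ C)
    (h0 : ∀ a x, 0 ≤ q a x) (hdir : ∀ a b, ∃ c, ∀ x, q a x ≤ q c x ∧ q b x ≤ q c x)
    (hpar : ∀ a x y, q a ((1 / 2 : ℝ) • (x + y)) + q a ((1 / 2 : ℝ) • (x - y))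
      = (q a x + q a y) / 2) :
    ∃ w : ℕ → E, (∀ n, w n ∈ Δ n) ∧ ∀ ε > 0, ∃ N, ∀ n ≥ N, ∀ m ≥ N, ∀ a,
      q a ((1 / 2 : ℝ) • (w n - w m)) ≤ ε := by
  let Q : E → ℝ := fun x => ⨆ a, q a x
  have hb : ∀ x ∈ Δ 0, BddAbove (Set.range fun a => q a x) := fun x hx =>
    ⟨C, by rintro _ ⟨a, rfl⟩; exact hC a x hx⟩
  have hQ0 : ∀ x, 0 ≤ Q x := fun x => Real.iSup_nonneg fun a => h0 a x
  have hQC : ∀ x ∈ Δ 0, Q x ≤ C := fun x hx => ciSup_le fun a => hC a x hx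
  have hΔ : ∀ n, Δ n ⊆ Δ 0 := fun n => hanti (Nat.zero_le n)
  have hmid : ∀ n, ∀ x ∈ Δ n, ∀ y ∈ Δ n, (1 / 2 : ℝ) • (x + y) ∈ Δ n := fun n x hx y hy => by
    rw [smul_add]
    exact hconv n hx hy (by norm_num) (by norm_num) (by norm_num)
  -- The supremum `Q` need not satisfy the parallelogram identity. Directedness provides one index
  -- `c` above both `a` and the index `b` testing the midpoint, and the identity at `c` suffices.
  have hkey : ∀ x ∈ Δ 0, ∀ y ∈ Δ 0, ∀ a,
      q a ((1 / 2 : ℝ) • (x - y)) ≤ (Q x + Q y) / 2 - Q ((1 / 2 : ℝ) • (x + y)) := by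
    intro x hx y hy a
    rw [le_sub_comm]
    refine ciSup_le fun b => ?_
    obtain ⟨c, hc⟩ := hdir a b
    have h1 := (hc ((1 / 2 : ℝ) • (x - y))).1
    have h2 := (hc ((1 / 2 : ℝ) • (x + y))).2
    have h3 : q c x ≤ Q x := le_ciSup (hb x hx) c
    have h4 : q c y ≤ Q y := le_ciSup (hb y hy) c
    linarith [hpar c x y]
  let I : ℕ → ℝ := fun n => sInf (Q '' Δ n)
  have hIb : ∀ n, BddBelow (Q '' Δ n) := fun n => ⟨0, by rintro _ ⟨x, _, rfl⟩; exact hQ0 x⟩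
  have hIle : ∀ n, ∀ x ∈ Δ n, I n ≤ Q x := fun n x hx => csInf_le (hIb n) ⟨x, hx, rfl⟩
  have hIm : Monotone I := fun n m h =>
    csInf_le_csInf (hIb n) ((hne m).image Q) (Set.image_mono (hanti h))
  have hIC : BddAbove (Set.range I) := ⟨C, by
    rintro _ ⟨n, rfl⟩
    obtain ⟨x, hx⟩ := hne n
    exact (hIle n x hx).trans (hQC x (hΔ n hx))⟩
  have hw : ∀ n : ℕ, ∃ x ∈ Δ n, Q x < I n + 1 / (n + 1) := fun n => by
    obtain ⟨_, ⟨x, hx, rfl⟩, h⟩ := exists_lt_of_csInf_lt ((hne n).image Q)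
      (lt_add_of_pos_right (I n) (Nat.one_div_pos_of_nat (n := n)))
    exact ⟨x, hx, h⟩
  choose w hwΔ hwQ using hw
  refine ⟨w, hwΔ, fun ε hε => ?_⟩
  -- Midpoints of later terms stay in `Δ k`, so their `Q` exceeds `sup I - ε/2`, while each term has
  -- `Q ≤ sup I + ε/2`.
  obtain ⟨k, hk⟩ := exists_lt_of_lt_ciSup (sub_lt_self (⨆ k, I k) (half_pos hε))
  obtain ⟨l, hl⟩ := exists_nat_one_div_lt (half_pos hε)
  have hsmall : ∀ n ≥ max k l, Q (w n) ≤ (⨆ k, I k) + ε / 2 := fun n hn => by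
    have h1 := hwQ n
    have h2 : I n ≤ ⨆ k, I k := le_ciSup hIC n
    have h3 : (1 : ℝ) / (n + 1) ≤ 1 / (l + 1) := Nat.one_div_le_one_div (le_of_max_le_right hn)
    linarith
  refine ⟨max k l, fun n hn m hm a => ?_⟩
  have h1 := hkey _ (hΔ n (hwΔ n)) _ (hΔ m (hwΔ m)) a
  have h2 := hIle k _ (hmid k _ (hanti (le_of_max_le_left hn) (hwΔ n)) _
    (hanti (le_of_max_le_left hm) (hwΔ m)))
  linarith [hsmall n hn, hsmall m hm]

/-! ### The energy along partitions. -/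

/-- The energy `∑ μ(E)² / ν(E)` of `μ` along a partition. -/
noncomputable def energy (ν μ : ba 𝒜) (P : Finpartition (⊤ : 𝒜)) : ℝ :=
  ∑ E ∈ P.parts, μ.1 E ^ 2 / ν.1 E

lemma energy_nonneg {ν : ba 𝒜} (hν : ∀ A, 0 ≤ ν.1 A) (μ : ba 𝒜) (P : Finpartition (⊤ : 𝒜)) :
    0 ≤ energy ν μ P :=
  Finset.sum_nonneg fun E _ => div_nonneg (sq_nonneg _) (hν E)

lemma energy_le {ν : ba 𝒜} (hν : ∀ A, 0 ≤ ν.1 A) {μ : ba 𝒜} {k : ℝ}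
    (h : ∀ A, |μ.1 A| ≤ k * ν.1 A) (P : Finpartition (⊤ : 𝒜)) :
    energy ν μ P ≤ k ^ 2 * ν.1 ⊤ := by
  rw [ba_finpartition ν P, Finset.mul_sum]
  refine Finset.sum_le_sum fun E _ => ?_
  refine div_le_of_le_mul₀ (hν E) (by have := hν E; positivity) ?_
  have := pow_le_pow_left₀ (abs_nonneg _) (h E) 2
  rw [sq_abs] at this
  linarith

lemma energy_parallelogram (ν μ κ : ba 𝒜) (P : Finpartition (⊤ : 𝒜)) :
    energy ν ((1 / 2 : ℝ) • (μ + κ)) P + energy ν ((1 / 2 : ℝ) • (μ - κ)) P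
      = (energy ν μ P + energy ν κ P) / 2 := by
  simp only [energy, ← Finset.sum_add_distrib, Finset.sum_div]
  refine Finset.sum_congr rfl fun E _ => ?_
  change (1 / 2 * (μ.1 E + κ.1 E)) ^ 2 / ν.1 E + (1 / 2 * (μ.1 E - κ.1 E)) ^ 2 / ν.1 E = _
  ring

/-- Cauchy–Schwarz in quotient form. Since `x / 0 = 0`, a term with `g i = 0` is lost on the right,
so `r i` must vanish there. -/
lemma sq_sum_le_sum_div_mul {ι : Type*} (s : Finset ι) {r g : ι → ℝ} (hg : ∀ i ∈ s, 0 ≤ g i)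
    (h : ∀ i ∈ s, g i = 0 → r i = 0) :
    (∑ i ∈ s, r i) ^ 2 ≤ (∑ i ∈ s, r i ^ 2 / g i) * ∑ i ∈ s, g i := by
  refine Finset.sum_sq_le_sum_mul_sum_of_sq_le_mul s
    (fun i hi => div_nonneg (sq_nonneg _) (hg i hi)) hg fun i hi => ?_
  by_cases h0 : g i = 0
  · simp [h0, h i hi h0]
  · rw [div_mul_cancel₀ _ h0]

/-- The passage from energy bounds back to the variation norm. -/
lemma sq_variationSum_le {ν : ba 𝒜} (hν : ∀ A, 0 ≤ ν.1 A) {μ : ba 𝒜}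
    (h : ∀ A, ν.1 A = 0 → μ.1 A = 0) (P : Finpartition (⊤ : 𝒜)) :
    variationSum μ.1 P ^ 2 ≤ energy ν μ P * ν.1 ⊤ := by
  have := sq_sum_le_sum_div_mul P.parts (r := fun E => |μ.1 E|) (fun E _ => hν E)
    (fun E _ hE => by simp [h E hE])
  simp only [sq_abs] at this
  rwa [← ba_finpartition ν P] at this

/-- Two different pairs of blocks can have the same intersection only if it is `⊥`, where `g`
vanishes. -/
lemma sum_parts_inf [DecidableEq 𝒜] (P P' : Finpartition (⊤ : 𝒜)) {g : 𝒜 → ℝ} (hg : g ⊥ = 0) :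
    ∑ E ∈ (P ⊓ P').parts, g E = ∑ E ∈ P.parts, ∑ E' ∈ P'.parts, g (E ⊓ E') := by
  rw [Finpartition.parts_inf, Finset.sum_erase _ hg, Finset.sum_image_of_pairwise_eq_zero,
    Finset.sum_product]
  rintro ⟨A, A'⟩ hA ⟨B, B'⟩ hB hne heq
  simp only [Finset.coe_product, Set.mem_prod, Finset.mem_coe] at hA hB
  suffices h : A ⊓ A' = ⊥ by simpa [h] using hg
  by_cases h1 : A = B
  · have h2 : A' ≠ B' := fun h2 => hne (by rw [h1, h2])
    refine disjoint_self.1 ((P'.disjoint hA.2 hB.2 h2).mono inf_le_right ?_)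
    exact (le_of_eq heq).trans inf_le_right
  · refine disjoint_self.1 ((P.disjoint hA.1 hB.1 h1).mono inf_le_left ?_)
    exact (le_of_eq heq).trans inf_le_left

/-- Cauchy–Schwarz inside each block of `P`; monotonicity under refinement makes the energies a
directed family. -/
lemma energy_le_energy_inf [DecidableEq 𝒜] {ν : ba 𝒜} (hν : ∀ A, 0 ≤ ν.1 A) {μ : ba 𝒜}
    (h : ∀ A, ν.1 A = 0 → μ.1 A = 0) (P P' : Finpartition (⊤ : 𝒜)) :
    energy ν μ P ≤ energy ν μ (P ⊓ P') := by
  unfold energy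
  rw [sum_parts_inf P P' (g := fun E => μ.1 E ^ 2 / ν.1 E) (by simp)]
  refine Finset.sum_le_sum fun E _ => ?_
  refine div_le_of_le_mul₀ (hν E)
    (Finset.sum_nonneg fun E' _ => div_nonneg (sq_nonneg _) (hν _)) ?_
  rw [ba_inf_finpartition μ P' E, ba_inf_finpartition ν P' E]
  exact sq_sum_le_sum_div_mul _ (fun _ _ => hν _) fun _ _ => h _

/-! ### Forward convex combinations encoded by weights. -/

/-- The convex weights on `ℕ` supported in `[n, ∞)`. -/
def simplexFrom (n : ℕ) : Set (ℕ →₀ ℝ) :=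
  {w | (∀ j, 0 ≤ w j) ∧ (∑ j ∈ w.support, w j = 1) ∧ ∀ j < n, w j = 0}

lemma simplexFrom_antitone : Antitone simplexFrom := fun _ _ h _ hw =>
  ⟨hw.1, hw.2.1, fun j hj => hw.2.2 j (hj.trans_le h)⟩

lemma single_mem_simplexFrom (n : ℕ) : Finsupp.single n 1 ∈ simplexFrom n := by
  refine ⟨fun j => ?_, ?_, fun j hj => ?_⟩
  · rw [Finsupp.single_apply]
    split_ifs <;> norm_num
  · exact (Finsupp.sum_single_index (h := fun _ x => x) rfl)
  · rw [Finsupp.single_apply, if_neg hj.ne']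

lemma convex_simplexFrom (n : ℕ) : Convex ℝ (simplexFrom n) := by
  rintro v ⟨hv0, hv1, hvn⟩ w ⟨hw0, hw1, hwn⟩ a b ha hb hab
  refine ⟨fun j => ?_, ?_, fun j hj => ?_⟩
  · exact add_nonneg (mul_nonneg ha (hv0 j)) (mul_nonneg hb (hw0 j))
  · have hl : ∀ u : ℕ →₀ ℝ, ∑ j ∈ u.support, u j
        = Finsupp.linearCombination ℝ (fun _ : ℕ => (1 : ℝ)) u := fun u => by
      simp [Finsupp.linearCombination_apply, Finsupp.sum]
    rw [hl] at hv1 hw1 ⊢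
    rw [map_add, map_smul, map_smul, hv1, hw1]
    simpa using hab
  · simp [hvn j hj, hwn j hj]

lemma le_of_mem_support {n : ℕ} {w : ℕ →₀ ℝ} (hw : w ∈ simplexFrom n) {j : ℕ}
    (hj : j ∈ w.support) : n ≤ j := by
  by_contra h
  exact Finsupp.mem_support_iff.1 hj (hw.2.2 j (not_le.1 h))

/-- The combination `∑ wⱼ Fⱼ`. -/
noncomputable abbrev comb (F : ℕ → ba 𝒜) : (ℕ →₀ ℝ) →ₗ[ℝ] ba 𝒜 := Finsupp.linearCombination ℝ F

lemma comb_apply (F : ℕ → ba 𝒜) (w : ℕ →₀ ℝ) (A : 𝒜) :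
    (comb F w).1 A = ∑ j ∈ w.support, w j * (F j).1 A := by
  simp [comb, Finsupp.linearCombination_apply, Finsupp.sum]

lemma comb_mem_convexHull (F : ℕ → ba 𝒜) {n : ℕ} {w : ℕ →₀ ℝ} (hw : w ∈ simplexFrom n) :
    comb F w ∈ convexHull ℝ (F '' Set.Ici n) := by
  rw [comb, Finsupp.linearCombination_apply]
  exact (convex_convexHull ℝ _).sum_mem (fun j _ => hw.1 j) hw.2.1 fun j hj =>
    subset_convexHull ℝ _ ⟨j, le_of_mem_support hw hj, rfl⟩

lemma tvNorm_comb_le (F : ℕ → ba 𝒜) {n : ℕ} {w : ℕ →₀ ℝ} (hw : w ∈ simplexFrom n) {c : ℝ}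
    (h : ∀ j ∈ w.support, tvNorm (F j) ≤ c) : tvNorm (comb F w) ≤ c := by
  have hconv : Convex ℝ {μ : ba 𝒜 | tvNorm μ ≤ c} := fun μ hμ κ hκ a b ha hb hab => by
    refine (tvNorm_add_le _ _).trans ?_
    have h1 := tvNorm_smul_le a μ
    have h2 := tvNorm_smul_le b κ
    rw [abs_of_nonneg ha] at h1
    rw [abs_of_nonneg hb] at h2
    have h3 := mul_le_mul_of_nonneg_left hμ ha
    have h4 := mul_le_mul_of_nonneg_left hκ hb
    have h5 : a * c + b * c = c := by rw [← add_mul, hab, one_mul]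
    linarith
  rw [comb, Finsupp.linearCombination_apply]
  exact hconv.sum_mem (fun j _ => hw.1 j) hw.2.1 h

lemma abs_comb_apply_le {ν : ba 𝒜} {T : ℕ → ba 𝒜} {k : ℝ} (h : ∀ j A, |(T j).1 A| ≤ k * ν.1 A)
    {n : ℕ} {w : ℕ →₀ ℝ} (hw : w ∈ simplexFrom n) (A : 𝒜) : |(comb T w).1 A| ≤ k * ν.1 A := by
  rw [comb_apply]
  calc |∑ j ∈ w.support, w j * (T j).1 A| ≤ ∑ j ∈ w.support, |w j * (T j).1 A| :=
        Finset.abs_sum_le_sum_abs _ _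
    _ ≤ ∑ j ∈ w.support, w j * (k * ν.1 A) := Finset.sum_le_sum fun j _ => by
        rw [abs_mul, abs_of_nonneg (hw.1 j)]
        exact mul_le_mul_of_nonneg_left (h j A) (hw.1 j)
    _ = k * ν.1 A := by rw [← Finset.sum_mul, hw.2.1, one_mul]

lemma comb_apply_eq_zero {ν : ba 𝒜} {T : ℕ → ba 𝒜} {k : ℝ} (h : ∀ j A, |(T j).1 A| ≤ k * ν.1 A)
    (w : ℕ →₀ ℝ) {A : 𝒜} (hA : ν.1 A = 0) : (comb T w).1 A = 0 := by
  rw [comb_apply]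
  refine Finset.sum_eq_zero fun j _ => ?_
  have := h j A
  rw [hA, mul_zero] at this
  rw [abs_nonpos_iff.1 this, mul_zero]

/-! ### Norm convergence of convex combinations. -/

/-- Countably many sequences, each dominated by a multiple of `ν`, have simultaneously
norm-Cauchy forward convex combinations. -/
lemma exists_comb_cauchy {ν : ba 𝒜} (hν : ν ∈ Prob 𝒜) (T : ℕ → ℕ → ba 𝒜) (k : ℕ → ℝ)
    (hT : ∀ m j A, |(T m j).1 A| ≤ k m * ν.1 A) :
    ∃ w : ℕ → ℕ →₀ ℝ, (∀ n, w n ∈ simplexFrom n) ∧ ∀ m, ∀ ε > 0, ∃ N, ∀ n ≥ N, ∀ l ≥ N,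
      tvNorm (comb (T m) (w n) - comb (T m) (w l)) ≤ ε := by
  classical
  have hν0 : ∀ A, 0 ≤ ν.1 A := hν.1
  -- The energy at level `m` is at most `k m ^ 2`, so the weighted energies sum to at most `∑ 2⁻ᵐ =
  -- 2`.
  let c : ℕ → ℝ := fun m => (1 / 2) ^ m / (k m ^ 2 + 1)
  have hc : ∀ m, 0 < c m := fun m => by positivity
  have hac : ∀ m w A, ν.1 A = 0 → (comb (T m) w).1 A = 0 := fun m w A hA =>
    comb_apply_eq_zero (hT m) w hA
  -- Indexing by a partition and a cutoff keeps every sum finite; common refinement and maximum give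
  -- directedness.
  let q : Finpartition (⊤ : 𝒜) × ℕ → (ℕ →₀ ℝ) → ℝ := fun a w =>
    ∑ m ∈ Finset.range a.2, c m * energy ν (comb (T m) w) a.1
  have hterm : ∀ m w P, 0 ≤ c m * energy ν (comb (T m) w) P := fun m w P =>
    mul_nonneg (hc m).le (energy_nonneg hν0 _ _)
  have hqmono : ∀ P P' M M', M ≤ M' → ∀ w, q (P, M) w ≤ q (P ⊓ P', M') w :=
    fun P P' M M' hM w =>
      (Finset.sum_le_sum fun m _ => mul_le_mul_of_nonneg_left
        (energy_le_energy_inf hν0 (hac m w) P P') (hc m).le).trans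
      (Finset.sum_le_sum_of_subset_of_nonneg (Finset.range_mono hM) fun m _ _ => hterm m w _)
  obtain ⟨w, hw, hcau⟩ := exists_cauchy_of_parallelogram q simplexFrom simplexFrom_antitone
    convex_simplexFrom (fun n => ⟨_, single_mem_simplexFrom n⟩) (C := 2)
    (fun a w hw => by
      refine le_trans (Finset.sum_le_sum fun m _ => ?_) (sum_geometric_two_le a.2)
      have h1 := energy_le hν0 (abs_comb_apply_le (hT m) hw) a.1
      rw [hν.2, mul_one] at h1
      change (1 / 2) ^ m / (k m ^ 2 + 1) * _ ≤ _
      rw [div_mul_eq_mul_div]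
      refine div_le_of_le_mul₀ (by positivity) (by positivity) ?_
      exact mul_le_mul_of_nonneg_left (by linarith) (by positivity))
    (fun a w => Finset.sum_nonneg fun m _ => hterm m w _)
    (fun a b => ⟨(a.1 ⊓ b.1, max a.2 b.2), fun x => ⟨hqmono _ _ _ _ (le_max_left _ _) x, by
      rw [inf_comm]
      exact hqmono _ _ _ _ (le_max_right _ _) x⟩⟩)
    (fun a x y => by
      simp only [q, ← Finset.sum_add_distrib, Finset.sum_div, map_smul, map_add, map_sub]
      refine Finset.sum_congr rfl fun m _ => ?_
      rw [← mul_add, energy_parallelogram]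
      ring)
  refine ⟨w, hw, fun m ε hε => ?_⟩
  -- Isolating the `m`-th term and cancelling `c m` leaves energy at most `(ε/2)²`, for half the
  -- difference.
  obtain ⟨N, hN⟩ := hcau (c m * (ε / 2) ^ 2) (mul_pos (hc m) (by positivity))
  refine ⟨N, fun n hn l hl => ?_⟩
  have h1 : tvNorm (comb (T m) ((1 / 2 : ℝ) • (w n - w l))) ≤ ε / 2 := tvNorm_le fun P => by
    refine abs_le_of_sq_le_sq' ?_ (by positivity) |>.2
    have h2 := sq_variationSum_le hν0 (hac m ((1 / 2 : ℝ) • (w n - w l))) P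
    rw [hν.2, mul_one] at h2
    refine h2.trans (le_of_mul_le_mul_left (le_trans ?_ (hN n hn l hl (P, m + 1))) (hc m))
    exact Finset.single_le_sum (f := fun m => c m * energy ν (comb (T m) _) P)
      (fun m _ => hterm m _ P) (Finset.self_mem_range_succ m)
  have h3 : comb (T m) (w n) - comb (T m) (w l)
      = (2 : ℝ) • comb (T m) ((1 / 2 : ℝ) • (w n - w l)) := by
    rw [map_smul, smul_smul, map_sub]
    norm_num
  rw [h3]
  refine (tvNorm_smul_le _ _).trans ?_
  rw [abs_of_pos two_pos]
  linarith

lemma comb_sub (F H : ℕ → ba 𝒜) (w : ℕ →₀ ℝ) :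
    comb (fun j => F j - H j) w = comb F w - comb H w := by
  simp [comb, Finsupp.linearCombination_apply, Finsupp.sum, smul_sub]

lemma restrict_comb (F : ℕ → ba 𝒜) (w : ℕ →₀ ℝ) (B : 𝒜) :
    restrict (comb F w) B = comb (fun j => restrict (F j) B) w := by
  change restrictₗ B (comb F w) = _
  simp [comb, Finsupp.linearCombination_apply, Finsupp.sum, map_sum]
  rfl

/-- Asymptotically dominated sequences have norm convergent forward convex combinations, with
limit approximable by multiples of `ν`. -/
lemma AsympDominated.exists_comb_tendsto {ν : ba 𝒜} (hν : ν ∈ Prob 𝒜) {H : ℕ → ba 𝒜}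
    (hH : AsympDominated ν H) :
    ∃ (w : ℕ → ℕ →₀ ℝ) (ξ : ba 𝒜), (∀ n, w n ∈ simplexFrom n) ∧
      (∀ ε > 0, ∃ N, ∀ n ≥ N, tvNorm (comb H (w n) - ξ) ≤ ε) ∧
      ∀ ε > 0, ∃ (k : ℝ) (T : ba 𝒜), (∀ A, |T.1 A| ≤ k * ν.1 A) ∧ tvNorm (ξ - T) ≤ ε := by
  classical
  have hT : ∀ m : ℕ, ∃ (k : ℝ) (N : ℕ) (T : ℕ → ba 𝒜), (∀ j A, |(T j).1 A| ≤ k * ν.1 A) ∧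
      ∀ j ≥ N, tvNorm (H j - T j) ≤ 1 / ((m : ℝ) + 1) := fun m => by
    obtain ⟨k, N, h⟩ := hH (1 / ((m : ℝ) + 1)) Nat.one_div_pos_of_nat
    obtain ⟨T₀, hT₀, -⟩ := h N le_rfl
    choose! T hT using h
    -- The filler `T₀` makes domination hold for every `j`; weights supported beyond `N` never see
    -- it.
    refine ⟨k, N, fun j => if N ≤ j then T j else T₀, fun j A => ?_, fun j hj => ?_⟩
    · dsimp only
      split_ifs with hj
      · exact (hT j hj).1 A
      · exact hT₀ A
    · dsimp only
      rw [if_pos hj]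
      exact (hT j hj).2
  choose k M T hTk hTH using hT
  obtain ⟨w, hw, hcau⟩ := exists_comb_cauchy hν T k hTk
  have happ : ∀ m, ∀ n ≥ M m, tvNorm (comb H (w n) - comb (T m) (w n)) ≤ 1 / ((m : ℝ) + 1) :=
    fun m n hn => by
      rw [← comb_sub]
      exact tvNorm_comb_le _ (hw n) fun j hj => hTH m j (hn.trans (le_of_mem_support (hw n) hj))
  obtain ⟨ξ, hξ⟩ := exists_tendsto_of_cauchy (fun n => comb H (w n)) fun ε hε => by
    obtain ⟨m, hm⟩ := exists_nat_one_div_lt (show 0 < ε / 3 by positivity)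
    obtain ⟨N, hN⟩ := hcau m (ε / 3) (by positivity)
    refine ⟨max N (M m), fun n hn l hl => ?_⟩
    have h1 := happ m n (le_of_max_le_right hn)
    have h2 := happ m l (le_of_max_le_right hl)
    have h3 := hN n (le_of_max_le_left hn) l (le_of_max_le_left hl)
    rw [tvNorm_sub_comm] at h2
    have h4 := tvNorm_sub_le_sub_add_sub (comb H (w n)) (comb (T m) (w n)) (comb H (w l))
    have h5 := tvNorm_sub_le_sub_add_sub (comb (T m) (w n)) (comb (T m) (w l)) (comb H (w l))
    linarith
  refine ⟨w, ξ, hw, hξ, fun ε hε => ?_⟩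
  obtain ⟨m, hm⟩ := exists_nat_one_div_lt (half_pos hε)
  obtain ⟨N, hN⟩ := hξ (ε / 2) (half_pos hε)
  refine ⟨k m, comb (T m) (w (max N (M m))), abs_comb_apply_le (hTk m) (hw _), ?_⟩
  have h1 := happ m _ (le_max_right N (M m))
  have h2 := hN _ (le_max_left N (M m))
  rw [tvNorm_sub_comm] at h2
  linarith [tvNorm_sub_le_sub_add_sub ξ (comb H (w (max N (M m))))
    (comb (T m) (w (max N (M m))))]

/-! ### Absolute continuity of the limit and the exceptional sets. -/

lemma sum_geometric_le_of_subset_Ici {n : ℕ} {s : Finset ℕ} (hs : ∀ j ∈ s, n ≤ j) :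
    ∑ j ∈ s, (1 / 2 : ℝ) ^ j ≤ 2 * (1 / 2) ^ n := by
  obtain ⟨M, hM⟩ := s.bddAbove
  have hsub : s ⊆ (Finset.range (M + 1)).image (n + ·) := fun j hj => by
    refine Finset.mem_image.2 ⟨j - n, Finset.mem_range.2 ?_, Nat.add_sub_cancel' (hs j hj)⟩
    have := hM hj
    omega
  refine (Finset.sum_le_sum_of_subset_of_nonneg hsub fun _ _ _ => by positivity).trans ?_
  rw [Finset.sum_image fun a _ b _ h => by simpa using h]
  simp only [pow_add, ← Finset.mul_sum]
  rw [mul_comm]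
  exact mul_le_mul_of_nonneg_right (sum_geometric_two_le _) (by positivity)

lemma absCont_of_approx {ν ξ : ba 𝒜} (hν : ∀ A, 0 ≤ ν.1 A)
    (h : ∀ ε > 0, ∃ (k : ℝ) (T : ba 𝒜), (∀ A, |T.1 A| ≤ k * ν.1 A) ∧ tvNorm (ξ - T) ≤ ε) :
    AbsCont ξ ν := fun ε hε => by
  obtain ⟨k, T, hT, hξT⟩ := h (ε / 2) (half_pos hε)
  -- The summand `1` keeps `δ` defined and positive when `k = 0`.
  refine ⟨ε / 2 / (|k| + 1), by positivity, fun A hA => ?_⟩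
  have h1 := (apply_le_totalVariation hν A).trans_lt hA
  rw [lt_div_iff₀ (by positivity)] at h1
  have h2 : |ξ.1 A - T.1 A| ≤ _ := abs_apply_le_tvNorm (ξ - T) A
  have h3 := abs_add_le (ξ.1 A - T.1 A) (T.1 A)
  rw [sub_add_cancel] at h3
  have h4 := mul_le_mul_of_nonneg_right (le_abs_self k) (hν A)
  linarith [hT A, hν A]

lemma tvNorm_restrict_le_of_approx {ν ξ T : ba 𝒜} {k : ℝ} (hT : ∀ A, |T.1 A| ≤ k * ν.1 A)
    (B : 𝒜) : tvNorm (restrict ξ B) ≤ tvNorm (ξ - T) + k * ν.1 B := by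
  have h1 := tvNorm_add_le (restrict (ξ - T) B) (restrict T B)
  rw [← restrict_add, sub_add_cancel] at h1
  have h2 : tvNorm (restrict T B) ≤ (restrict (k • ν) B).1 ⊤ :=
    tvNorm_le_of_dominated fun A => hT _
  have h3 : (restrict (k • ν) B).1 ⊤ = k * ν.1 B := by
    rw [restrict_apply, inf_top_eq]
    rfl
  linarith [tvNorm_restrict_le (ξ - T) B]

end FinAdd

theorem mainTheorem3 {Ω : Type*} [Nonempty Ω] (𝒜 : BooleanSubalgebra (Set Ω))
    (F : ℕ → FinAdd.ba 𝒜) (hF : ∃ C : ℝ, ∀ n, FinAdd.tvNorm (F n) ≤ C)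
    (ν : FinAdd.ba 𝒜) (hν : ν ∈ FinAdd.Prob 𝒜) :
    ∃ ξ ∈ FinAdd.baAbs ν, ∃ G ∈ FinAdd.Gam F, ∃ A : ℕ → 𝒜,
      Tendsto (fun n => FinAdd.tvNorm (FinAdd.restrict (G n) (A n) - ξ)) atTop (𝓝 0) ∧
      Summable (fun n => (ν : 𝒜 → ℝ) (A n)ᶜ) := by
  open FinAdd in
  obtain ⟨C, hC⟩ := hF
  obtain ⟨φ, hφ, H, D, hH, hD⟩ := exists_splitting hν hC
  obtain ⟨w, ξ, hw, hlim, happ⟩ := hH.exists_comb_tendsto hν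
  -- Off `B n`, every `F (φ j)` entering the `n`-th combination is close to `H j`.
  let B : ℕ → 𝒜 := fun n => (w n).support.sup D
  have hB : ∀ n, ν.1 (B n) ≤ 4 * (1 / 2) ^ n := fun n => by
    refine (ba_finset_sup_le hν.1 _ _).trans
      ((Finset.sum_le_sum fun j _ => (hD j).1).trans ?_)
    rw [← Finset.mul_sum]
    linarith [sum_geometric_le_of_subset_Ici fun j hj => le_of_mem_support (hw n) hj]
  have hgeo : Summable fun n : ℕ => 4 * (1 / 2 : ℝ) ^ n := summable_geometric_two.mul_left 4
  refine ⟨ξ, absCont_of_approx hν.1 happ, fun n => comb (F ∘ φ) (w n), fun n => ?_,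
    fun n => (B n)ᶜ, ?_, ?_⟩
  · refine convexHull_mono ?_ (comb_mem_convexHull (F ∘ φ) (hw n))
    rintro _ ⟨j, hj, rfl⟩
    exact ⟨φ j, (Set.mem_Ici.1 hj).trans (hφ.id_le j), rfl⟩
  · have hrest : ∀ n, tvNorm (restrict (comb (F ∘ φ) (w n) - comb H (w n)) (B n)ᶜ)
        ≤ 2 * (1 / 2) ^ n := fun n => by
      rw [← comb_sub, restrict_comb]
      refine tvNorm_comb_le _ (hw n) fun j hj => ?_
      refine (tvNorm_restrict_mono _ (compl_le_compl (Finset.le_sup hj))).trans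
        ((hD j).2.trans ?_)
      exact mul_le_mul_of_nonneg_left (pow_le_pow_of_le_one (by norm_num) (by norm_num)
        (le_of_mem_support (hw n) hj)) two_pos.le
    have hbound : ∀ n, tvNorm (restrict (comb (F ∘ φ) (w n)) (B n)ᶜ - ξ) ≤
        2 * (1 / 2) ^ n + tvNorm (comb H (w n) - ξ) + tvNorm (restrict ξ (B n)) := fun n => by
      have h1 : restrict (comb (F ∘ φ) (w n)) (B n)ᶜ - ξ =
          restrict (comb (F ∘ φ) (w n) - comb H (w n)) (B n)ᶜ
            + restrict (comb H (w n) - ξ) (B n)ᶜ - restrict ξ (B n) := by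
        have h2 := sub_restrict ξ (B n)
        rw [restrict_sub, restrict_sub, ← h2]
        abel
      rw [h1]
      have h2 := tvNorm_sub_le (restrict (comb (F ∘ φ) (w n) - comb H (w n)) (B n)ᶜ
            + restrict (comb H (w n) - ξ) (B n)ᶜ) (restrict ξ (B n))
      have h3 := tvNorm_add_le (restrict (comb (F ∘ φ) (w n) - comb H (w n)) (B n)ᶜ)
        (restrict (comb H (w n) - ξ) (B n)ᶜ)
      linarith [hrest n, tvNorm_restrict_le (comb H (w n) - ξ) (B n)ᶜ]
    refine Metric.tendsto_atTop.2 fun ε hε => ?_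
    have hε4 : 0 < ε / 4 := by positivity
    -- `k` is fixed before `n`, so `|k| * ν(B n)` tends to zero and `ξ` is small on `B n`.
    obtain ⟨k, T, hT, hξT⟩ := happ (ε / 4) hε4
    obtain ⟨N₁, hN₁⟩ := hlim (ε / 4) hε4
    have hzero := hgeo.tendsto_atTop_zero
    obtain ⟨N₂, hN₂⟩ := eventually_atTop.1 ((hzero.eventually_lt_const hε4).and
      ((hzero.const_mul |k|).eventually_lt_const (show |k| * 0 < ε / 4 by simpa using hε4)))
    refine ⟨max N₁ N₂, fun n hn => ?_⟩
    rw [Real.dist_eq, sub_zero, abs_of_nonneg (tvNorm_nonneg _)]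
    obtain ⟨h1, h2⟩ := hN₂ n (le_of_max_le_right hn)
    have h3 := hN₁ n (le_of_max_le_left hn)
    have h4 := tvNorm_restrict_le_of_approx (ξ := ξ) hT (B n)
    have h5 := mul_le_mul_of_nonneg_right (le_abs_self k) (hν.1 (B n))
    have h6 := mul_le_mul_of_nonneg_left (hB n) (abs_nonneg k)
    have h7 : (0 : ℝ) < (1 / 2) ^ n := by positivity
    refine (hbound n).trans_lt ?_
    linarith
  · refine Summable.of_nonneg_of_le (fun n => hν.1 _) (fun n => ?_) hgeo
    rw [compl_compl]
    exact hB n
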